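/- \textbf{Setting.} Let $\mathcal G$ be a finite Feynman graph (connected or not) of the rank $3$ tensor model over $U(1)$: its vertices are the three quartic vertices $\sum\varphi_{p_1p_2p_3}\bar\varphi_{p_1'p_2p_3}\varphi_{p_1'p_2'p_3'}\bar\varphi_{p_1p_2'p_3'}$ (and the two analogues in which index $2$ or index $3$ plays the role of index $1$), the mass vertices $\sum\bar\varphi\varphi$ and the wave function vertices $\sum\bar\varphi|p_s|\varphi$, $s=1,2,3$; propagators join pairwise some of the fields $\varphi$ to fields $\bar\varphi$, identifying equal index positions, and the remaining fields are the external legs. \textbf{Colored extension.} $\mathcal G_{\mathrm{color}}$ is the bipartite graph with one vertex for each field of $\mathcal G$ (white for $\varphi$, black for $\bar\varphi$), a line of color $0$ for each propagator, and, for $c=1,2,3$, a line of color $c$ between two fields of the same vertex of $\mathcal G$ that share their index number $c$. A vertex of $\mathcal G_{\mathrm{color}}$ belonging to an external field carries an external leg of color $0$. \textbf{Ribbon graphs, pinching and genus.} A jacket $J$ is the ribbon graph obtained from $\mathcal G_{\mathrm{color}}$ by arranging the half-lines at each white vertex in a cyclic order $(0abc)$ of the four colors, and at each black vertex in the opposite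 order; cyclic orders are taken up to orientation, so there are three jackets. The pinched jacket $\widetilde J$ is the closed ribbon graph obtained from $J$ by closing each external leg, that is, by joining its two strands; it has the same vertices and the same lines as $J$ (external legs are not counted as lines). The genus $g$ of a closed ribbon graph with $V$ vertices, $L$ lines, $F$ faces and $C$ connected components is defined by $2C-2g=V-L+F$. \textbf{Boundary graph.} $\partial\mathcal G$ has the external legs of $\mathcal G$ as vertices, and for each $c=1,2,3$ a line of color $c$ between the two ends of each open strand (a path alternating between the colors $c$ and $0$ from one external leg to another). It is a closed ribbon graph with the cyclic order $(123)$ of the colors at white vertices and the opposite one at black vertices; $g_{\partial\mathcal G}$ is its genus ($0$ if there are no external legs). \textbf{Lemma (Genus bounds).} For each of the three jackets $J$, $$g_{\widetilde J}\ \ge\ g_{\partial\mathcal G},\qquad\text{and}\qquad \sum_J g_{\widetilde J}-3\,g_{\partial\mathcal G}\in\mathbb N=\{0,1,2,\dots\}.$$ -/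

import Mathlib

/-! ### Ribbon graphs -/

/-- A ribbon graph on the finite set `H` of half-lines. `rotation` turns around each vertex
(its cycles are the vertices, with the cyclic order of their half-lines), `flip` exchanges the two
halves of each line. The fixed points of `flip` are the external legs (half-lines that are not
joined to another one); the graph is closed (a vacuum graph) when there are none. -/
structure RibbonGraph (H : Type*) where
  rotation : Equiv.Perm H
  flip : Equiv.Perm H
  flip_flip : ∀ h, flip (flip h) = h

namespace RibbonGraph

variable {H : Type*} (R : RibbonGraph H)

/-- The number of vertices. -/
noncomputable def numVertices : ℕ :=
  Nat.card (Quotient (Equiv.Perm.SameCycle.setoid R.rotation))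

/-- The number of lines; external legs are not lines. -/
noncomputable def numLines : ℕ :=
  {l : Sym2 H | ∃ h, R.flip h ≠ h ∧ l = s(h, R.flip h)}.ncard

/-- The number of faces of the graph in which all external legs are pinched. A face is followed by
running along a half-line, changing to the other half of its line, and turning to the next half-line
around the vertex that is reached. A strand that runs out along an external leg (`flip h = h`) is
joined to the other strand of the same leg and runs back to the vertex: this is the pinching.
For a closed ribbon graph these are its usual faces. -/
noncomputable def numFaces : ℕ :=
  Nat.card (Quotient (Equiv.Perm.SameCycle.setoid (R.rotation * R.flip)))

/-- The number of connected components. -/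
noncomputable def numComponents : ℕ :=
  Nat.card (MulAction.orbitRel.Quotient
    (Subgroup.closure ({R.rotation, R.flip} : Set (Equiv.Perm H))) H)

/-- The genus of the closed ribbon graph obtained by pinching all external legs (of the graph itself
if it is closed), summed over the connected components: `2 C - 2 g = V - L + F`. Its values are
a priori rational; nothing is rounded or truncated. -/
noncomputable def genus : ℚ :=
  (2 * (R.numComponents : ℚ) - ((R.numVertices : ℚ) - (R.numLines : ℚ) + (R.numFaces : ℚ))) / 2

end RibbonGraph

/-! ### Colored graphs, jackets and the boundary graph -/

/-- A bipartite graph on `V` with lines colored by `C`: every vertex carries exactly one half-line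
of each color. `line c v` is the vertex joined to `v` by its line of color `c`, and
`line c v = v` if that half-line is an external leg. Lines join white vertices to black vertices. -/
structure ColoredGraph (C V : Type*) where
  white : V → Bool
  line : C → Equiv.Perm V
  line_line : ∀ c v, line c (line c v) = v
  line_white : ∀ c v, line c v ≠ v → white (line c v) = !white v

namespace ColoredGraph

variable {C V : Type*}

/-- The ribbon subgraph of a colored graph defined by a cycle `τ` of its colors: the colors are
arranged around the white vertices in the cyclic order `τ`, and around the black vertices in the
opposite one, so that the faces are alternating in two colors that are consecutive in the cycle. -/
def jacket (Γ : ColoredGraph C V) (τ : Equiv.Perm C) : RibbonGraph (V × C) where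
  rotation :=
    { toFun := fun h => (h.1, if Γ.white h.1 then τ h.2 else τ.symm h.2)
      invFun := fun h => (h.1, if Γ.white h.1 then τ.symm h.2 else τ h.2)
      left_inv := by
        rintro ⟨v, c⟩
        by_cases hv : Γ.white v <;> simp [hv]
      right_inv := by
        rintro ⟨v, c⟩
        by_cases hv : Γ.white v <;> simp [hv] }
  flip :=
    { toFun := fun h => (Γ.line h.2 h.1, h.2)
      invFun := fun h => (Γ.line h.2 h.1, h.2)
      left_inv := fun h => by simp [Γ.line_line]
      right_inv := fun h => by simp [Γ.line_line] }
  flip_flip := fun h => by simp [Γ.line_line]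

/-- The three jackets of a graph with the colors `0, 1, 2, 3`, that is, the three cycles of these
colors up to orientation. -/
def jacketCycle : Fin 3 → Equiv.Perm (Fin 4) :=
  ![c[0, 1, 2, 3], c[0, 2, 3, 1], c[0, 3, 1, 2]]

/-- Every cyclic order of the four colors is that of exactly one of the three jackets, up to
orientation. -/
theorem exists_jacketCycle :
    ∀ τ : Equiv.Perm (Fin 4), (∀ a b, ∃ n : Fin 4, (τ ^ (n : ℕ)) a = b) →
      ∃ J : Fin 3, (τ = jacketCycle J ∨ τ = (jacketCycle J)⁻¹) ∧
        ∀ J' : Fin 3, (τ = jacketCycle J' ∨ τ = (jacketCycle J')⁻¹) → J' = J := by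
  decide

section Boundary

variable (Γ : ColoredGraph (Fin 4) V)

/-- The vertices that carry an external leg of color `0`. -/
def IsExternal (v : V) : Prop := Γ.line 0 v = v

/-- Two consecutive steps on a strand (or face) of colors `0` and `c`: along the line of color `c`,
then along the line of color `0`, if it is not an external leg. The argument `c` in
`{0, 1, 2}` stands for the color `c + 1` in `{1, 2, 3}`. -/
def strandStep (c : Fin 3) : Equiv.Perm V := Γ.line 0 * Γ.line c.succ

theorem strandStep_pow_reverse (c : Fin 3) (n : ℕ) (x : V) :
    (Γ.strandStep c ^ n) (Γ.line 0 ((Γ.strandStep c ^ n) x)) = Γ.line 0 x := by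
  induction n generalizing x with
  | zero => simp
  | succ n ih =>
    have h : Γ.strandStep c (Γ.line 0 (Γ.strandStep c ((Γ.strandStep c ^ n) x)))
        = Γ.line 0 ((Γ.strandStep c ^ n) x) := by
      simp [strandStep, Γ.line_line]
    have h2 : (Γ.strandStep c ^ (n + 1)) x = Γ.strandStep c ((Γ.strandStep c ^ n) x) := by
      rw [pow_succ', Equiv.Perm.mul_apply]
    rw [h2, pow_succ, Equiv.Perm.mul_apply, h, ih]

variable [Finite V]

theorem exists_strand_return (c : Fin 3) (v : {v : V // Γ.IsExternal v}) :
    ∃ n : ℕ, 0 < n ∧ Γ.IsExternal ((Γ.strandStep c ^ n) v.1) :=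
  ⟨orderOf (Γ.strandStep c), orderOf_pos _, by
    rw [pow_orderOf_eq_one]; exact v.2⟩

open scoped Classical in
/-- The number of double steps on the external strand of colors `0` and `c` that starts at the
external vertex `v`. -/
noncomputable def strandLength (c : Fin 3) (v : {v : V // Γ.IsExternal v}) : ℕ :=
  Nat.find (Γ.exists_strand_return c v)

/-- The external vertex at the other end of the external strand of colors `0` and `c` that starts
at the external vertex `v`. -/
noncomputable def strandEnd (c : Fin 3) (v : {v : V // Γ.IsExternal v}) :
    {v : V // Γ.IsExternal v} :=
  ⟨(Γ.strandStep c ^ Γ.strandLength c v) v.1, by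
    classical exact (Nat.find_spec (Γ.exists_strand_return c v)).2⟩

theorem strandLength_pos (c : Fin 3) (v : {v : V // Γ.IsExternal v}) : 0 < Γ.strandLength c v := by
  classical exact (Nat.find_spec (Γ.exists_strand_return c v)).1

theorem strandLength_min (c : Fin 3) (v : {v : V // Γ.IsExternal v}) {n : ℕ} (h0 : 0 < n)
    (hn : n < Γ.strandLength c v) : ¬ Γ.IsExternal ((Γ.strandStep c ^ n) v.1) := by
  classical
  intro h
  exact Nat.find_min (Γ.exists_strand_return c v) hn ⟨h0, h⟩

theorem strandEnd_strandEnd (c : Fin 3) (v : {v : V // Γ.IsExternal v}) :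
    Γ.strandEnd c (Γ.strandEnd c v) = v := by
  set w := Γ.strandEnd c v with hw
  set N := Γ.strandLength c v with hN
  have hwv : w.1 = (Γ.strandStep c ^ N) v.1 := rfl
  have hext : ∀ x, Γ.IsExternal (Γ.line 0 x) → Γ.IsExternal x := by
    intro x hx
    exact (Γ.line 0).injective hx
  have key : ∀ k ≤ N, (Γ.strandStep c ^ k) w.1 = Γ.line 0 ((Γ.strandStep c ^ (N - k)) v.1) := by
    intro k hk
    have h := Γ.strandStep_pow_reverse c k ((Γ.strandStep c ^ (N - k)) v.1)
    rw [← Equiv.Perm.mul_apply (Γ.strandStep c ^ k) (Γ.strandStep c ^ (N - k)), ← pow_add,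
      Nat.add_sub_cancel' hk, ← hwv] at h
    have h2 : Γ.line 0 w.1 = w.1 := w.2
    rwa [h2] at h
  have hlast : (Γ.strandStep c ^ N) w.1 = v.1 := by
    rw [key N le_rfl, Nat.sub_self, pow_zero]; exact v.2
  have hlen : Γ.strandLength c w = N := by
    apply le_antisymm
    · by_contra! hlt
      refine Γ.strandLength_min c w (Γ.strandLength_pos c v) hlt ?_
      rw [← hN, hlast]; exact v.2
    · by_contra! hlt
      have hpos := Γ.strandLength_pos c w
      have hx : Γ.IsExternal ((Γ.strandStep c ^ Γ.strandLength c w) w.1) :=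
        (Γ.strandEnd c w).2
      rw [key _ hlt.le] at hx
      exact Γ.strandLength_min c v (by omega) (by omega) (hext _ hx)
  apply Subtype.ext
  change (Γ.strandStep c ^ Γ.strandLength c w) w.1 = v.1
  rw [hlen, hlast]

theorem strandEnd_white (h : ∀ (c : Fin 3) v, Γ.line c.succ v ≠ v) (c : Fin 3)
    (v : {v : V // Γ.IsExternal v}) :
    Γ.white (Γ.strandEnd c v).1 = !Γ.white v.1 := by
  have hstep : ∀ x, ¬ Γ.IsExternal (Γ.strandStep c x) →
      Γ.white (Γ.strandStep c x) = Γ.white x := by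
    intro x hx
    have h1 : Γ.line 0 (Γ.line c.succ x) ≠ Γ.line c.succ x := by
      intro h1
      apply hx
      simp only [IsExternal, strandStep, Equiv.Perm.mul_apply, h1]
    change Γ.white (Γ.line 0 (Γ.line c.succ x)) = _
    rw [Γ.line_white _ _ h1, Γ.line_white _ _ (h c x), Bool.not_not]
  have hpow : ∀ k, k < Γ.strandLength c v → Γ.white ((Γ.strandStep c ^ k) v.1) = Γ.white v.1 := by
    intro k
    induction k with
    | zero => simp
    | succ k ih =>
      intro hk
      have hmin := Γ.strandLength_min c v k.succ_pos hk
      rw [pow_succ', Equiv.Perm.mul_apply] at hmin ⊢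
      rw [hstep _ hmin, ih (by omega)]
  obtain ⟨k, hk⟩ : ∃ k, Γ.strandLength c v = k + 1 :=
    ⟨Γ.strandLength c v - 1, by have := Γ.strandLength_pos c v; omega⟩
  have hend : (Γ.strandEnd c v).1
      = Γ.line 0 (Γ.line c.succ ((Γ.strandStep c ^ k) v.1)) := by
    change (Γ.strandStep c ^ Γ.strandLength c v) v.1 = _
    rw [hk, pow_succ', Equiv.Perm.mul_apply]; rfl
  have hfix : (Γ.strandEnd c v).1 = Γ.line c.succ ((Γ.strandStep c ^ k) v.1) := by
    have h1 : Γ.line 0 (Γ.strandEnd c v).1 = (Γ.strandEnd c v).1 := (Γ.strandEnd c v).2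
    rw [← h1, hend, Γ.line_line]
  rw [hfix, Γ.line_white _ _ (h c _), hpow k (by omega)]

/-- The boundary graph of a graph all of whose external legs have color `0`. Its vertices are the
external legs, its lines of color `c` are the external strands of colors `0` and `c`. -/
noncomputable def boundary (h : ∀ (c : Fin 3) v, Γ.line c.succ v ≠ v) :
    ColoredGraph (Fin 3) {v : V // Γ.IsExternal v} where
  white v := Γ.white v.1
  line c :=
    { toFun := Γ.strandEnd c
      invFun := Γ.strandEnd c
      left_inv := Γ.strandEnd_strandEnd c
      right_inv := Γ.strandEnd_strandEnd c }
  line_line c v := Γ.strandEnd_strandEnd c v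
  line_white c v _ := Γ.strandEnd_white h c v

end Boundary

end ColoredGraph

/-! ### Graphs of the rank 3 tensor model -/

/-- The vertices of the model. `quartic s` is
`∑ φ(p₁,p₂,p₃) φ̄(p₁',p₂,p₃) φ(p₁',p₂',p₃') φ̄(p₁,p₂',p₃')` for `s = 0`, and its analogues in which
the index number `s + 1` plays the role of the first one; `mass` is `∑ φ̄ φ`, and `wave s` is
`∑ φ̄ |p| φ` with the index `p` number `s + 1`. -/
inductive VertexKind
  | quartic (s : Fin 3)
  | mass
  | wave (s : Fin 3)
  deriving DecidableEq

/-- The number of fields `φ` (equal to the number of fields `φ̄`) at a vertex. -/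
def VertexKind.numPairs : VertexKind → ℕ
  | .quartic _ => 2
  | .mass => 1
  | .wave _ => 1

/-- A graph of the model with set of vertices `I`. The fields of the graph are the triples
`⟨i, k, b⟩`, the `k`-th field `φ` (`b = true`) or `φ̄` (`b = false`) of the vertex `i`.
`contraction` joins fields `φ` to fields `φ̄` by propagators; its fixed points are the external
fields. At a quartic vertex the `k`-th `φ` and the `k`-th `φ̄` share two indices. -/
structure TensorGraph (I : Type*) where
  kind : I → VertexKind
  contraction : Equiv.Perm (Σ i, Fin (kind i).numPairs × Bool)
  contraction_contraction : ∀ f, contraction (contraction f) = f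
  contraction_bar : ∀ f, contraction f ≠ f → (contraction f).2.2 = !f.2.2

namespace TensorGraph

variable {I : Type*} (G : TensorGraph I)

/-- The fields of a graph. -/
abbrev Field : Type _ := Σ i, Fin (G.kind i).numPairs × Bool

/-- The field that shares with `f` the index number `c + 1` at the vertex of `f`. -/
def partner (c : Fin 3) (f : G.Field) : G.Field :=
  ⟨f.1, if G.kind f.1 = .quartic c then Fin.rev f.2.1 else f.2.1, !f.2.2⟩

theorem partner_partner (c : Fin 3) (f : G.Field) : G.partner c (G.partner c f) = f := by
  obtain ⟨i, k, b⟩ := f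
  by_cases h : G.kind i = .quartic c <;> simp [partner, h]

/-- The colored extension: one vertex of the colored theory for each field (white for `φ`, black for
`φ̄`), the propagators as lines of color `0`, and inside each vertex of the model a line of color
`c = 1, 2, 3` between the two fields that share an index number `c`. -/
def colorExtension : ColoredGraph (Fin 4) G.Field where
  white f := f.2.2
  line := Fin.cons G.contraction fun c =>
    { toFun := G.partner c
      invFun := G.partner c
      left_inv := G.partner_partner c
      right_inv := G.partner_partner c }
  line_line := by
    intro c
    refine Fin.cases ?_ (fun c => ?_) c
    · exact G.contraction_contraction
    · exact G.partner_partner c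
  line_white := by
    intro c
    refine Fin.cases ?_ (fun c => ?_) c
    · exact G.contraction_bar
    · intro f _; rfl

theorem colorExtension_line_succ_ne (c : Fin 3) (f : G.Field) :
    G.colorExtension.line c.succ f ≠ f := by
  intro h
  have h2 : (!f.2.2) = f.2.2 := congrArg (fun g : G.Field => g.2.2) h
  simp at h2

/-- The boundary graph `∂G`, a closed graph with the three colors `1, 2, 3`
(numbered `0, 1, 2` here). -/
noncomputable def boundaryGraph [Finite I] :
    ColoredGraph (Fin 3) {f : G.Field // G.colorExtension.IsExternal f} :=
  G.colorExtension.boundary G.colorExtension_line_succ_ne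

/-- The genus of the boundary graph, as the ribbon graph that is its own unique jacket. -/
noncomputable def boundaryGenus [Finite I] : ℚ :=
  (G.boundaryGraph.jacket (finRotate 3)).genus

/-- The genus of the pinched jacket associated with the jacket `J` of the colored extension. -/
noncomputable def pinchedJacketGenus (J : Fin 3) : ℚ :=
  (G.colorExtension.jacket (ColoredGraph.jacketCycle J)).genus

end TensorGraph

/-!
The inequality holds for every bipartite graph with the colors `0, 1, 2, 3` whose external legs all
have color `0`. Let `(0abc)` be the cyclic order of a jacket. The external faces of the pinched
jacket run alternately along the external strands of colors `a` and `c`, so they are the faces of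
colors `a`, `c` of the boundary graph. The strands of color `b`, opposite to `0`, are disjoint paths
of lines of colors `0` and `b` in the jacket; their ribbons join the external faces in the same way
as the lines of color `b` join the `ac`-faces of the boundary graph. Hence the surface of the
boundary graph, without the discs of its other faces, is a part of the surface of the pinched
jacket, and its genus cannot be larger. Both genera are integers, which gives the second claim.

The comparison of the genera is made algebraically. A list of permutations of the half-lines has a
`genusDefect`, twice its genus by the Riemann-Hurwitz formula, with numbers of orbits expressed as
dimensions of spaces of invariant functions. Scott's lemma (`two_mul_orbitRank_pair_le`) and the
submodularity of the rank of orbits (`orbitRank_union_add_le`) imply that the defect does not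
increase when a permutation is omitted (`genusDefect_drop_le`) or two neighbors are multiplied
(`genusDefect_fuse_le`), and that it is unchanged when a permutation is split into factors with
additive lengths (`genusDefect_split`). The map of first return to a subset is such a factor
(`orbitRank_add_of_firstReturn`). For the rotation `σ` and the flip `α` of the jacket,
`[σ, α, (σ * α)⁻¹]` reduces in this way to the first return `(0b)` of `σ` to the colors `0`, `b`,
that of `α` to the same colors, and the inverse of that of `σ * α` to the external legs; the first
two are multiplied, and the first return of their product to the external legs is given by the
lines of color `b` of the boundary graph. What remains is a model of the surface of the boundary
graph (`genusDefect_jacket_three`). The defect is even by the sign of permutations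
(`even_genusDefect`).
-/

open Module

/-! ### Orbits and invariant functions -/

/-- The functions on `H` that are invariant under all permutations of the set `S`. -/
def invariants {H : Type*} (S : Set (Equiv.Perm H)) : Submodule ℚ (H → ℚ) where
  carrier := {f | ∀ g ∈ S, ∀ x, f (g x) = f x}
  add_mem' hf hf' g hg x := by simp [hf g hg x, hf' g hg x]
  zero_mem' _ _ _ := rfl
  smul_mem' r f hf g hg x := by simp [hf g hg x]

/-- The number of elements of `H` minus the number of orbits of `S`, written as the codimension of
the space of invariant functions. For a single permutation it is the least number of transpositions
with that product. -/
noncomputable def orbitRank {H : Type*} (S : Set (Equiv.Perm H)) : ℤ :=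
  Nat.card H - finrank ℚ (invariants S)

/-- Twice the genus of the branched covering of the sphere with monodromies the permutations of the
list and the inverse of their product (Riemann-Hurwitz formula), summed over its components. -/
noncomputable def genusDefect {H : Type*} (L : List (Equiv.Perm H)) : ℤ :=
  (L.map fun g => orbitRank {g}).sum + orbitRank {L.prod} - 2 * orbitRank {g | g ∈ L}

section Invariants

variable {H : Type*}

theorem mem_invariants {S : Set (Equiv.Perm H)} {f : H → ℚ} :
    f ∈ invariants S ↔ ∀ g ∈ S, ∀ x, f (g x) = f x := Iff.rfl

theorem mem_invariants_singleton {g : Equiv.Perm H} {f : H → ℚ} :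
    f ∈ invariants {g} ↔ ∀ x, f (g x) = f x := by
  simp [mem_invariants]

theorem invariants_singleton_inv (g : Equiv.Perm H) :
    invariants {g⁻¹} = invariants {g} := by
  ext f
  simp only [mem_invariants_singleton]
  exact ⟨fun h x => by simpa using (h (g x)).symm, fun h x => by simpa using (h (g⁻¹ x)).symm⟩

theorem orbitRank_inv (g : Equiv.Perm H) : orbitRank {g⁻¹} = orbitRank {g} := by
  rw [orbitRank, invariants_singleton_inv, orbitRank]

/-- A function invariant under a set of permutations is invariant under the permutations
generated by it. -/
theorem invariants_closure (S : Set (Equiv.Perm H)) :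
    invariants (Subgroup.closure S : Set (Equiv.Perm H)) = invariants S := by
  ext f
  refine ⟨fun h g hg => h g (Subgroup.subset_closure hg), fun h g hg => ?_⟩
  induction hg using Subgroup.closure_induction with
  | mem g hg => exact h g hg
  | one => simp
  | mul a b _ _ ha hb => intro x; rw [Equiv.Perm.mul_apply, ha, hb]
  | inv a _ ha => intro x; simpa using (ha (a⁻¹ x)).symm

theorem invariants_le_of_subset_closure {S T : Set (Equiv.Perm H)}
    (h : T ⊆ Subgroup.closure S) : invariants S ≤ invariants T := by
  rw [← invariants_closure S]
  exact fun f hf g hg => hf g (h hg)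

theorem apply_eq_of_sameCycle {g : Equiv.Perm H} {f : H → ℚ} (hf : f ∈ invariants {g}) {x y : H}
    (h : g.SameCycle x y) : f x = f y := by
  obtain ⟨n, hn⟩ := h
  rw [← invariants_closure] at hf
  have hmem : g ^ n ∈ Subgroup.closure {g} :=
    Subgroup.zpow_mem _ (Subgroup.subset_closure (Set.mem_singleton g)) n
  rw [← hn]
  exact (hf _ hmem x).symm

theorem finrank_respecting_setoid [Finite H] (r : Setoid H) (P : Submodule ℚ (H → ℚ))
    (hP : ∀ f, f ∈ P ↔ ∀ x y, r x y → f x = f y) : finrank ℚ P = Nat.card (Quotient r) := by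
  have e : (Quotient r → ℚ) ≃ₗ[ℚ] P :=
    { toFun := fun F => ⟨fun x => F (Quotient.mk r x), (hP _).2 fun x y h => by
        rw [Quotient.sound h]⟩
      map_add' := fun _ _ => rfl
      map_smul' := fun _ _ => rfl
      invFun := fun f => Quotient.lift f.1 ((hP _).1 f.2)
      left_inv := fun F => by
        funext q
        induction q using Quotient.inductionOn
        rfl
      right_inv := fun f => rfl }
  have := Fintype.ofFinite (Quotient r)
  rw [← e.finrank_eq, finrank_fintype_fun_eq_card, Nat.card_eq_fintype_card]

theorem finrank_invariants_singleton [Finite H] (g : Equiv.Perm H) :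
    finrank ℚ (invariants {g}) = Nat.card (Quotient (Equiv.Perm.SameCycle.setoid g)) := by
  refine finrank_respecting_setoid _ _ fun f => ⟨fun hf x y h => apply_eq_of_sameCycle hf h,
    fun hf => mem_invariants_singleton.2 fun x => (hf _ _ ?_).symm⟩
  exact ⟨1, by simp⟩

theorem finrank_invariants [Finite H] (S : Set (Equiv.Perm H)) :
    finrank ℚ (invariants S) =
      Nat.card (MulAction.orbitRel.Quotient (Subgroup.closure S) H) := by
  refine finrank_respecting_setoid _ _ fun f => ?_
  rw [← invariants_closure]
  constructor
  · rintro hf x y ⟨g, rfl⟩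
    exact hf g.1 g.2 y
  · exact fun hf g hg x => hf _ _ ⟨⟨g, hg⟩, rfl⟩

theorem orbitRank_mono [Finite H] {S T : Set (Equiv.Perm H)}
    (h : S ⊆ Subgroup.closure T) : orbitRank S ≤ orbitRank T := by
  have := Submodule.finrank_mono (invariants_le_of_subset_closure h)
  unfold orbitRank
  omega

theorem orbitRank_congr [Finite H] {S T : Set (Equiv.Perm H)}
    (h : S ⊆ Subgroup.closure T) (h' : T ⊆ Subgroup.closure S) : orbitRank S = orbitRank T :=
  le_antisymm (orbitRank_mono h) (orbitRank_mono h')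

theorem orbitRank_conj [Finite H] (g h : Equiv.Perm H) :
    orbitRank {h * g * h⁻¹} = orbitRank {g} := by
  have e : invariants {h * g * h⁻¹} ≃ₗ[ℚ] invariants {g} :=
    { toFun := fun f => ⟨fun x => f.1 (h x), mem_invariants_singleton.2 fun x => by
        simpa using mem_invariants_singleton.1 f.2 (h x)⟩
      map_add' := fun _ _ => rfl
      map_smul' := fun _ _ => rfl
      invFun := fun f => ⟨fun x => f.1 (h⁻¹ x), mem_invariants_singleton.2 fun x => by
        simpa using mem_invariants_singleton.1 f.2 (h⁻¹ x)⟩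
      left_inv := fun f => by ext x; simp
      right_inv := fun f => by ext x; simp }
  rw [orbitRank, orbitRank, e.finrank_eq]

/-- Orbit ranks are submodular: enlarging the orbits of `T` to those of `S` costs less in the
presence of further permutations `R`. -/
theorem orbitRank_union_add_le [Finite H] {S T : Set (Equiv.Perm H)}
    (h : T ⊆ Subgroup.closure S) (R : Set (Equiv.Perm H)) :
    orbitRank (S ∪ R) + orbitRank T ≤ orbitRank S + orbitRank (T ∪ R) := by
  have hun : ∀ A B : Set (Equiv.Perm H), invariants (A ∪ B) = invariants A ⊓ invariants B := by
    intro A B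
    ext f
    exact ⟨fun hf => ⟨fun g hg => hf g (.inl hg), fun g hg => hf g (.inr hg)⟩,
      fun hf g hg => hg.elim (hf.1 g) (hf.2 g)⟩
  have hle := invariants_le_of_subset_closure h
  have h1 := Submodule.finrank_sup_add_finrank_inf_eq (invariants S) (invariants (T ∪ R))
  have h2 : invariants S ⊓ invariants (T ∪ R) = invariants (S ∪ R) := by
    rw [hun, hun, ← inf_assoc, inf_eq_left.2 hle]
  have h3 : finrank ℚ (invariants S ⊔ invariants (T ∪ R) : Submodule ℚ (H → ℚ))
      ≤ finrank ℚ (invariants T) :=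
    Submodule.finrank_mono (sup_le hle (by rw [hun]; exact inf_le_left))
  rw [h2] at h1
  unfold orbitRank
  omega

/-- Scott's lemma for permutation representations; equivalently, the genus in the Riemann-Hurwitz
formula is not negative. -/
theorem two_mul_orbitRank_pair_le [Finite H] (a b : Equiv.Perm H) :
    2 * orbitRank {a, b} ≤ orbitRank {a} + orbitRank {b} + orbitRank {a * b} := by
  classical
  have := Fintype.ofFinite H
  let D : Equiv.Perm H → (H → ℚ) →ₗ[ℚ] (H → ℚ) := fun g => LinearMap.funLeft ℚ ℚ g - LinearMap.id
  have hD : ∀ g f x, D g f x = f (g x) - f x := fun _ _ _ => rfl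
  have hker : ∀ g, LinearMap.ker (D g) = invariants {g} := by
    intro g
    ext f
    rw [LinearMap.mem_ker, mem_invariants_singleton]
    exact ⟨fun h x => sub_eq_zero.1 (congrFun h x), fun h => funext fun x => sub_eq_zero.2 (h x)⟩
  have hpair : invariants {a, b} = invariants {a} ⊓ invariants {b} := by
    ext f
    simp [mem_invariants]
  have hn : finrank ℚ (H → ℚ) = Nat.card H := by
    rw [finrank_fintype_fun_eq_card, Nat.card_eq_fintype_card]
  have hra := LinearMap.finrank_range_add_finrank_ker (D a)
  have hrb := LinearMap.finrank_range_add_finrank_ker (D b)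
  rw [hker, hn] at hra hrb
  have hsum := Submodule.finrank_sup_add_finrank_inf_eq (LinearMap.range (D a))
    (LinearMap.range (D b))
  -- `D a` maps the functions invariant under `a * b` into both ranges.
  have hinf : finrank ℚ (invariants {a * b}) ≤ finrank ℚ (invariants {a, b}) +
      finrank ℚ (LinearMap.range (D a) ⊓ LinearMap.range (D b) : Submodule ℚ (H → ℚ)) := by
    let T := (D a).domRestrict (invariants {a * b})
    have h1 := LinearMap.finrank_range_add_finrank_ker T
    have h2 : finrank ℚ (LinearMap.range T) ≤
        finrank ℚ (LinearMap.range (D a) ⊓ LinearMap.range (D b) : Submodule ℚ (H → ℚ)) := by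
      refine Submodule.finrank_mono ?_
      rintro _ ⟨⟨f, hf⟩, rfl⟩
      refine ⟨⟨f, rfl⟩, ⟨fun x => - f (a x), ?_⟩⟩
      funext x
      have := mem_invariants_singleton.1 hf x
      rw [Equiv.Perm.mul_apply] at this
      change - f (a (b x)) - - f (a x) = f (a x) - f x
      rw [this]; ring
    have h3 : finrank ℚ (LinearMap.ker T) ≤ finrank ℚ (invariants {a, b}) := by
      have h4 : (LinearMap.ker T).map (invariants {a * b}).subtype ≤ invariants {a, b} := by
        rintro _ ⟨⟨f, hf⟩, hT, rfl⟩
        have hfa : f ∈ invariants {a} := by rw [← hker]; exact hT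
        have hfb : f ∈ invariants {b} := mem_invariants_singleton.2 fun x => by
          have := mem_invariants_singleton.1 hf x
          rwa [Equiv.Perm.mul_apply, mem_invariants_singleton.1 hfa] at this
        rw [hpair]
        exact ⟨hfa, hfb⟩
      have h5 := Submodule.finrank_mono h4
      rwa [← (Submodule.equivMapOfInjective _ (Submodule.subtype_injective _) _).finrank_eq] at h5
    omega
  -- The functionals that vanish on both ranges are the invariant ones.
  have hsup : Nat.card H ≤ finrank ℚ (invariants {a, b}) +
      finrank ℚ (LinearMap.range (D a) ⊔ LinearMap.range (D b) : Submodule ℚ (H → ℚ)) := by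
    set U := LinearMap.range (D a) ⊔ LinearMap.range (D b) with hU
    have h1 := Subspace.finrank_add_finrank_dualAnnihilator_eq U
    let T : Dual ℚ (H → ℚ) →ₗ[ℚ] (H → ℚ) :=
      { toFun := fun ξ x => ξ (Pi.single x 1)
        map_add' := fun _ _ => rfl
        map_smul' := fun _ _ => rfl }
    have hT : Function.Injective T := fun ξ η h => by
      refine LinearMap.pi_ext' fun x => LinearMap.ext_ring ?_
      exact congrFun h x
    have hDs : ∀ (g : Equiv.Perm H) x,
        D g (Pi.single (g x) 1) = Pi.single x 1 - Pi.single (g x) 1 := by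
      intro g x
      funext y
      rw [hD]
      simp [Pi.single_apply]
    have h2 : U.dualAnnihilator.map T ≤ invariants {a, b} := by
      rintro _ ⟨ξ, hξ, rfl⟩
      have h3 : ∀ g : Equiv.Perm H, LinearMap.range (D g) ≤ U → ∀ x, T ξ (g x) = T ξ x := by
        intro g hg x
        have h4 := (Submodule.mem_dualAnnihilator ξ).1 hξ _ (hg ⟨Pi.single (g x) 1, rfl⟩)
        rw [hDs, map_sub, sub_eq_zero] at h4
        exact h4.symm
      rw [hpair]
      exact ⟨mem_invariants_singleton.2 (h3 a le_sup_left),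
        mem_invariants_singleton.2 (h3 b le_sup_right)⟩
    have h3 := Submodule.finrank_mono h2
    rw [← (Submodule.equivMapOfInjective _ hT _).finrank_eq] at h3
    omega
  unfold orbitRank
  omega

theorem list_prod_mem_closure {L : List (Equiv.Perm H)} {S : Set (Equiv.Perm H)}
    (h : ∀ g ∈ L, g ∈ S) : L.prod ∈ Subgroup.closure S :=
  Subgroup.list_prod_mem _ fun g hg => Subgroup.subset_closure (h g hg)

end Invariants

/-! ### Genus of a list of permutations -/

section Defect

variable {H : Type*} [Finite H]

theorem orbitRank_one : orbitRank {(1 : Equiv.Perm H)} = 0 := by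
  have := Fintype.ofFinite H
  have h : invariants {(1 : Equiv.Perm H)} = ⊤ := by
    ext f
    simp [mem_invariants_singleton]
  rw [orbitRank, h, finrank_top, finrank_fintype_fun_eq_card, Nat.card_eq_fintype_card, sub_self]

theorem orbitRank_mul_le (a b : Equiv.Perm H) :
    orbitRank {a * b} ≤ orbitRank {a} + orbitRank {b} := by
  have h1 := two_mul_orbitRank_pair_le a b
  have h2 : orbitRank {a * b} ≤ orbitRank {a, b} := orbitRank_mono <| by
    simpa using mul_mem (Subgroup.subset_closure (Set.mem_insert a {b}))
      (Subgroup.subset_closure (Set.mem_insert_of_mem a (Set.mem_singleton b)))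
  omega

/-- Forgetting a permutation does not increase the genus. -/
theorem genusDefect_drop_le (L₁ L₂ : List (Equiv.Perm H)) (a : Equiv.Perm H) :
    genusDefect (L₁ ++ L₂) ≤ genusDefect (L₁ ++ a :: L₂) := by
  set p := L₁.prod
  set q := L₂.prod
  set a' := q⁻¹ * a * q⁻¹⁻¹ with ha'
  have hprod : (L₁ ++ a :: L₂).prod = (p * q) * a' := by simp [p, q, ha', mul_assoc]
  have hprod' : (L₁ ++ L₂).prod = p * q := by simp [p, q]
  have h1 := two_mul_orbitRank_pair_le (p * q) a'
  have h2 : orbitRank {a'} = orbitRank {a} := orbitRank_conj a q⁻¹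
  set S : Set (Equiv.Perm H) := {g | g ∈ L₁ ++ L₂} with hS
  have hq : q ∈ Subgroup.closure S := list_prod_mem_closure fun g hg => by simp [hS, hg]
  have hpq : p * q ∈ Subgroup.closure S := by
    rw [← hprod']
    exact list_prod_mem_closure fun g hg => hg
  have h3 := orbitRank_union_add_le (S := S) (T := {p * q}) (by simpa using hpq) {a'}
  have h4 : orbitRank (S ∪ {a'}) = orbitRank {g | g ∈ L₁ ++ a :: L₂} := by
    have hmono : ∀ T, S ⊆ T → q ∈ Subgroup.closure T := fun T hT => Subgroup.closure_mono hT hq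
    refine orbitRank_congr (Set.union_subset ?_ ?_) ?_
    · refine fun g hg => Subgroup.subset_closure ?_
      simp only [hS, Set.mem_ofPred_eq, List.mem_append, List.mem_cons] at hg ⊢
      tauto
    · rw [Set.singleton_subset_iff]
      have hqT : q ∈ Subgroup.closure {g | g ∈ L₁ ++ a :: L₂} := by
        refine hmono _ fun g hg => ?_
        simp only [hS, Set.mem_ofPred_eq, List.mem_append, List.mem_cons] at hg ⊢
        tauto
      have haT : a ∈ Subgroup.closure {g | g ∈ L₁ ++ a :: L₂} :=
        Subgroup.subset_closure (by simp)
      exact mul_mem (mul_mem (inv_mem hqT) haT) (inv_mem (inv_mem hqT))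
    · intro g hg
      have hqT := hmono (S ∪ {a'}) Set.subset_union_left
      simp only [Set.mem_ofPred_eq, List.mem_append, List.mem_cons] at hg
      by_cases hga : g = a
      · have h5 : g = q * a' * q⁻¹ := by rw [hga, ha']; group
        rw [h5]
        exact mul_mem (mul_mem hqT (Subgroup.subset_closure (by simp))) (inv_mem hqT)
      · refine Subgroup.subset_closure (.inl ?_)
        simp only [hS, Set.mem_ofPred_eq, List.mem_append]
        tauto
  have h5 : ({p * q} ∪ {a'} : Set (Equiv.Perm H)) = {p * q, a'} := rfl
  rw [h4, h5] at h3
  have hsum : ((L₁ ++ a :: L₂).map fun g => orbitRank {g}).sum =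
      ((L₁ ++ L₂).map fun g => orbitRank {g}).sum + orbitRank {a} := by
    simp only [List.map_append, List.map_cons, List.sum_append, List.sum_cons]
    ring
  unfold genusDefect
  rw [hprod, hprod', hsum, ← hS]
  omega

/-- Replacing two consecutive permutations by their product does not increase the genus. -/
theorem genusDefect_fuse_le (L₁ L₂ : List (Equiv.Perm H)) (a b : Equiv.Perm H) :
    genusDefect (L₁ ++ (a * b) :: L₂) ≤ genusDefect (L₁ ++ a :: b :: L₂) := by
  have h1 := two_mul_orbitRank_pair_le a b
  have hab : a * b ∈ Subgroup.closure ({a, b} : Set (Equiv.Perm H)) :=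
    mul_mem (Subgroup.subset_closure (by simp)) (Subgroup.subset_closure (by simp))
  have h3 := orbitRank_union_add_le (S := {a, b}) (T := {a * b}) (by simpa using hab)
    {g | g ∈ L₁ ++ L₂}
  have h4 : ({a, b} ∪ {g | g ∈ L₁ ++ L₂} : Set (Equiv.Perm H)) = {g | g ∈ L₁ ++ a :: b :: L₂} := by
    ext g
    simp only [Set.mem_union, Set.mem_insert_iff, Set.mem_singleton_iff, Set.mem_ofPred_eq,
      List.mem_append, List.mem_cons]
    tauto
  have h5 : ({a * b} ∪ {g | g ∈ L₁ ++ L₂} : Set (Equiv.Perm H)) =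
      {g | g ∈ L₁ ++ (a * b) :: L₂} := by
    ext g
    simp only [Set.mem_union, Set.mem_singleton_iff, Set.mem_ofPred_eq,
      List.mem_append, List.mem_cons]
    tauto
  rw [h4, h5] at h3
  unfold genusDefect
  simp only [List.map_append, List.map_cons, List.sum_append, List.sum_cons, List.prod_append,
    List.prod_cons, ← mul_assoc] at h3 ⊢
  omega

/-- Splitting a permutation into factors whose lengths add up does not change the genus. -/
theorem genusDefect_split (L₁ L₂ : List (Equiv.Perm H)) {a b : Equiv.Perm H}
    (h : orbitRank {a} + orbitRank {b} = orbitRank {a * b}) :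
    genusDefect (L₁ ++ a :: b :: L₂) = genusDefect (L₁ ++ (a * b) :: L₂) := by
  refine le_antisymm ?_ (genusDefect_fuse_le L₁ L₂ a b)
  have h1 := two_mul_orbitRank_pair_le a b
  have hab : a * b ∈ Subgroup.closure ({a, b} : Set (Equiv.Perm H)) :=
    mul_mem (Subgroup.subset_closure (by simp)) (Subgroup.subset_closure (by simp))
  have h3 : orbitRank {g | g ∈ L₁ ++ (a * b) :: L₂} ≤ orbitRank {g | g ∈ L₁ ++ a :: b :: L₂} := by
    refine orbitRank_mono fun g hg => ?_
    simp only [Set.mem_ofPred_eq, List.mem_append, List.mem_cons] at hg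
    by_cases hg' : g = a * b
    · rw [hg']
      refine Subgroup.closure_mono ?_ hab
      intro g hg
      simp only [Set.mem_insert_iff, Set.mem_singleton_iff, Set.mem_ofPred_eq, List.mem_append,
        List.mem_cons] at hg ⊢
      tauto
    · refine Subgroup.subset_closure ?_
      simp only [Set.mem_ofPred_eq, List.mem_append, List.mem_cons]
      tauto
  unfold genusDefect
  simp only [List.map_append, List.map_cons, List.sum_append, List.sum_cons, List.prod_append,
    List.prod_cons, ← mul_assoc] at h3 ⊢
  omega

/-- A permutation `ψ` with support in `D` that permutes the points of each cycle of `π` splits off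
`π` with additive lengths if it cuts each cycle of `π` so that the points of `D` come to lie in
different cycles. -/
theorem orbitRank_add_of_cut {ψ θ : Equiv.Perm H} (D : Set H)
    (hψ : ∀ x ∉ D, ψ x = x) (hπ : ∀ x, (ψ * θ).SameCycle x (ψ x))
    (hθ : ∀ x ∈ D, ∀ y ∈ D, θ.SameCycle x y → x = y) :
    orbitRank {ψ} + orbitRank {θ} = orbitRank {ψ * θ} := by
  classical
  have := Fintype.ofFinite H
  refine le_antisymm ?_ (orbitRank_mul_le ψ θ)
  have h1 := Submodule.finrank_sup_add_finrank_inf_eq (invariants {ψ}) (invariants {θ})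
  have h2 : invariants {ψ * θ} ≤ invariants {ψ} ⊓ invariants {θ} := by
    intro f hf
    have hfψ : f ∈ invariants {ψ} := mem_invariants_singleton.2 fun x =>
      (apply_eq_of_sameCycle hf (hπ x)).symm
    refine ⟨hfψ, mem_invariants_singleton.2 fun x => ?_⟩
    rw [← mem_invariants_singleton.1 hf x, Equiv.Perm.mul_apply,
      mem_invariants_singleton.1 hfψ]
  -- Any function is the sum of one that extends its values on `D` constantly along the cycles
  -- of `θ`, and of one that vanishes on `D`.
  have h3 : invariants {ψ} ⊔ invariants {θ} = ⊤ := by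
    rw [eq_top_iff]
    intro f _
    let k : H → ℚ := fun x => if h : ∃ d ∈ D, θ.SameCycle d x then f h.choose else 0
    have hkD : ∀ d ∈ D, k d = f d := by
      intro d hd
      have h : ∃ d' ∈ D, θ.SameCycle d' d := ⟨d, hd, Equiv.Perm.SameCycle.refl _ _⟩
      simp only [k, dif_pos h]
      rw [hθ _ h.choose_spec.1 d hd h.choose_spec.2]
    have hk : k ∈ invariants {θ} := mem_invariants_singleton.2 fun x => by
      simp only [k, Equiv.Perm.sameCycle_apply_right]
    have hfk : f - k ∈ invariants {ψ} := mem_invariants_singleton.2 fun x => by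
      by_cases hx : x ∈ D
      · have hψx : ψ x ∈ D := by
          by_contra h
          have := ψ.injective (hψ _ h)
          rw [this] at h
          exact h hx
        simp [hkD x hx, hkD _ hψx]
      · rw [hψ x hx]
    rw [← sub_add_cancel f k]
    exact Submodule.add_mem_sup hfk hk
  rw [h3, finrank_top, finrank_fintype_fun_eq_card, ← Nat.card_eq_fintype_card] at h1
  have h4 := Submodule.finrank_mono h2
  unfold orbitRank
  omega

/-- The map of first return to `D` under a permutation splits off with additive lengths. -/
theorem orbitRank_add_of_firstReturn {π ψ : Equiv.Perm H} (D : Set H)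
    (hψ : ∀ x ∉ D, ψ x = x)
    (hD : ∀ x ∈ D, ∃ k : ℕ, 0 < k ∧ (π ^ k) x = ψ x ∧ ∀ j, 0 < j → j < k → (π ^ j) x ∉ D) :
    orbitRank {ψ} + orbitRank {ψ⁻¹ * π} = orbitRank {π} := by
  set θ := ψ⁻¹ * π with hθ
  have hπ : π = ψ * θ := by rw [hθ]; group
  rw [hπ]
  have hinv : ∀ x ∉ D, ψ⁻¹ x = x := fun x hx => by
    rw [Equiv.Perm.inv_eq_iff_eq, hψ x hx]
  refine orbitRank_add_of_cut D hψ (fun x => ?_) fun x hx y hy hxy => ?_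
  · rw [← hπ]
    by_cases hx : x ∈ D
    · obtain ⟨k, -, hk, -⟩ := hD x hx
      rw [← hk]
      exact ⟨k, by simp⟩
    · rw [hψ x hx]
  · obtain ⟨k, hk0, hk, hmin⟩ := hD x hx
    -- Up to its return to `D`, the orbit of `x` under `θ` is the one under `π`; then it closes up.
    have hblock : ∀ n : ℕ, ∃ j < k, (θ ^ n) x = (π ^ j) x := by
      intro n
      induction n with
      | zero => exact ⟨0, hk0, rfl⟩
      | succ n ih =>
        obtain ⟨j, hj, h⟩ := ih
        rw [pow_succ', Equiv.Perm.mul_apply, h, hθ, Equiv.Perm.mul_apply,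
          ← Equiv.Perm.mul_apply π, ← pow_succ']
        rcases Nat.lt_or_ge (j + 1) k with hjk | hjk
        · exact ⟨j + 1, hjk, hinv _ (hmin _ j.succ_pos hjk)⟩
        · refine ⟨0, hk0, ?_⟩
          rw [show j + 1 = k by omega, hk]
          simp
    obtain ⟨n, -, hn⟩ := hxy.exists_pow_eq'
    obtain ⟨j, hj, h⟩ := hblock n
    rw [hn] at h
    rcases Nat.eq_zero_or_pos j with rfl | hj0
    · exact h.symm
    · exact absurd (h ▸ hy) (hmin j hj0 hj)

theorem orbitRank_swap [DecidableEq H] {x y : H} (hxy : x ≠ y) :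
    orbitRank {Equiv.swap x y} = 1 := by
  have := Fintype.ofFinite H
  let T : (H → ℚ) →ₗ[ℚ] ℚ :=
    { toFun := fun f => f x - f y
      map_add' := fun f f' => by simp only [Pi.add_apply]; ring
      map_smul' := fun r f => by simp only [Pi.smul_apply, smul_eq_mul, RingHom.id_apply]; ring }
  have hT : ∀ f, T f = f x - f y := fun _ => rfl
  have hker : LinearMap.ker T = invariants {Equiv.swap x y} := by
    ext f
    rw [LinearMap.mem_ker, hT, sub_eq_zero, mem_invariants_singleton]
    refine ⟨fun h z => ?_, fun h => ?_⟩
    · rcases eq_or_ne z x with rfl | hzx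
      · simp [h]
      · rcases eq_or_ne z y with rfl | hzy
        · simp [h]
        · rw [Equiv.swap_apply_of_ne_of_ne hzx hzy]
    · simpa using h y
  have hrange : LinearMap.range T = ⊤ := by
    refine LinearMap.range_eq_top.2 fun r => ⟨fun z => if z = x then r else 0, ?_⟩
    simp [hT, hxy.symm]
  have h := LinearMap.finrank_range_add_finrank_ker T
  rw [hrange, hker, finrank_top, finrank_self, finrank_fintype_fun_eq_card,
    ← Nat.card_eq_fintype_card] at h
  unfold orbitRank
  omega

/-- The parity of a permutation is that of its length. -/
theorem sign_eq_neg_one_pow_orbitRank [Fintype H] [DecidableEq H] (g : Equiv.Perm H) :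
    Equiv.Perm.sign g = (-1) ^ orbitRank {g} := by
  induction hn : g.support.card using Nat.strong_induction_on generalizing g with
  | _ n ih =>
    by_cases hg : g = 1
    · rw [hg, orbitRank_one]; simp
    · obtain ⟨x, hx⟩ : ∃ x, g x ≠ x := by
        by_contra! h
        exact hg (Equiv.ext h)
      set t := Equiv.swap x (g x) with ht
      set g' := t * g with hg'
      have htg : g = t * g' := by rw [hg', ← mul_assoc, ht, Equiv.swap_mul_self, one_mul]
      have hfix : g' x = x := by simp [hg', ht]
      have hlt : g'.support.card < n := by
        rw [← hn]
        exact Equiv.Perm.card_support_swap_mul hx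
      have hadd : orbitRank {t} + orbitRank {g'} = orbitRank {g} := by
        have h1 : ∀ z, g'.SameCycle x z → z = x := by
          rintro z ⟨m, rfl⟩
          exact Equiv.Perm.zpow_apply_eq_self_of_apply_eq_self hfix m
        rw [htg]
        refine orbitRank_add_of_cut {x, g x} (fun z hz => ?_) (fun z => ?_) ?_
        · simp only [Set.mem_insert_iff, Set.mem_singleton_iff, not_or] at hz
          exact Equiv.swap_apply_of_ne_of_ne hz.1 hz.2
        · rw [← htg]
          rcases eq_or_ne z x with rfl | hzx
          · rw [ht, Equiv.swap_apply_left]; exact ⟨1, by simp⟩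
          · rcases eq_or_ne z (g x) with rfl | hzy
            · rw [ht, Equiv.swap_apply_right]; exact ⟨-1, by simp⟩
            · rw [ht, Equiv.swap_apply_of_ne_of_ne hzx hzy]
        · rintro z (rfl | rfl) w (rfl | rfl) h
          · rfl
          · exact (h1 _ h).symm
          · exact h1 _ h.symm
          · rfl
      have h1 := ih _ hlt g' rfl
      rw [← hadd, ht, orbitRank_swap hx.symm, zpow_add, zpow_one, ← h1, htg,
        Equiv.Perm.sign_mul, ht, Equiv.Perm.sign_swap hx.symm]

theorem even_genusDefect (L : List (Equiv.Perm H)) : Even (genusDefect L) := by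
  classical
  have := Fintype.ofFinite H
  have hsum : ∀ L : List (Equiv.Perm H),
      (-1 : ℤˣ) ^ (L.map fun g => orbitRank {g}).sum = Equiv.Perm.sign L.prod := by
    intro L
    induction L with
    | nil => simp
    | cons g L ih =>
      rw [List.map_cons, List.sum_cons, zpow_add, ih, List.prod_cons, Equiv.Perm.sign_mul,
        ← sign_eq_neg_one_pow_orbitRank]
  have h : Even ((L.map fun g => orbitRank {g}).sum + orbitRank {L.prod}) := by
    by_contra hodd
    rw [Int.not_even_iff_odd] at hodd
    have h1 : (-1 : ℤˣ) ^ ((L.map fun g => orbitRank {g}).sum + orbitRank {L.prod}) = 1 := by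
      rw [zpow_add, hsum, ← sign_eq_neg_one_pow_orbitRank, Int.units_mul_self]
    rw [hodd.neg_one_zpow] at h1
    exact absurd h1 (by decide)
  exact h.sub (even_two_mul _)

end Defect

/-! ### Genus of ribbon graphs, and added fixed points -/

section Genus

/-- The length of an involution is the number of pairs of points that it exchanges, which is half the
number of the points that it moves. -/
theorem orbitRank_involution {H : Type*} [Finite H] (s : Equiv.Perm H) (hs : ∀ x, s (s x) = x) :
    orbitRank {s} = ({l : Sym2 H | ∃ h, s h ≠ h ∧ l = s(h, s h)}.ncard : ℤ) ∧
      2 * orbitRank {s} = ({h | s h ≠ h}.ncard : ℤ) := by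
  classical
  have := Fintype.ofFinite H
  let q : H → Sym2 H := fun h => s(h, s h)
  have hq : ∀ x y, q x = q y ↔ y = x ∨ y = s x := by
    intro x y
    simp only [q, Sym2.eq_iff]
    constructor
    · rintro (⟨h, -⟩ | ⟨-, h⟩)
      · exact .inl h.symm
      · exact .inr h.symm
    · rintro (rfl | rfl)
      · simp
      · simp [hs]
  have hinv : finrank ℚ (invariants {s}) = (Finset.univ.image q).card := by
    rw [finrank_respecting_setoid (Setoid.ker q)]
    · rw [Nat.card_congr (Setoid.quotientKerEquivRange q), ← Set.ncard_coe_finset]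
      simp [Set.ncard, Set.encard, Nat.card, ENat.card]
    · intro f
      rw [mem_invariants_singleton]
      refine ⟨fun h x y hxy => ?_, fun h x => h _ _ ((hq _ _).2 (.inr (hs x).symm))⟩
      rcases (hq _ _).1 hxy with rfl | rfl
      · rfl
      · exact (h x).symm
  set N : Finset H := Finset.univ.filter fun h => s h ≠ h with hN
  set F : Finset H := Finset.univ.filter fun h => ¬ s h ≠ h with hF
  have hcard : N.card + F.card = Fintype.card H := Finset.card_filter_add_card_filter_not _
  have himage : (Finset.univ.image q).card = (N.image q).card + F.card := by
    have h1 : Finset.univ = N ∪ F := (Finset.filter_union_filter_not_eq _ _).symm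
    rw [h1, Finset.image_union, Finset.card_union_of_disjoint, Finset.card_image_of_injOn (s := F)]
    · intro x hx y _ hxy
      simp only [hF, Finset.coe_filter, Finset.mem_univ, true_and, not_not, Set.mem_ofPred_eq] at hx
      rcases (hq _ _).1 hxy with h | h
      · exact h.symm
      · rw [h, hx]
    · rw [Finset.disjoint_left]
      intro l hl hl'
      obtain ⟨x, hx, rfl⟩ := Finset.mem_image.1 hl
      obtain ⟨y, hy, hxy⟩ := Finset.mem_image.1 hl'
      simp only [hN, hF, Finset.mem_filter, Finset.mem_univ, true_and, not_not] at hx hy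
      rcases (hq _ _).1 hxy with h | h
      · exact hx (h ▸ hy)
      · rw [hy] at h
        exact hx (h ▸ hy)
  have hNcard : N.card = 2 * (N.image q).card := by
    rw [Finset.card_eq_sum_card_image q N, mul_comm, ← smul_eq_mul, ← Finset.sum_const]
    refine Finset.sum_congr rfl fun l hl => ?_
    obtain ⟨x, hx, rfl⟩ := Finset.mem_image.1 hl
    simp only [hN, Finset.mem_filter, Finset.mem_univ, true_and] at hx
    have h1 : N.filter (fun y => q y = q x) = {x, s x} := by
      ext y
      simp only [hN, Finset.mem_filter, Finset.mem_univ, true_and, Finset.mem_insert,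
        Finset.mem_singleton]
      refine ⟨fun h => (hq _ _).1 h.2.symm, fun h => ⟨?_, ((hq _ _).2 h).symm⟩⟩
      rcases h with rfl | rfl
      · exact hx
      · rw [hs]; exact hx.symm
    rw [h1, Finset.card_pair hx.symm]
  have hlines : {l : Sym2 H | ∃ h, s h ≠ h ∧ l = s(h, s h)}.ncard = (N.image q).card := by
    rw [← Set.ncard_coe_finset]
    congr 1
    ext l
    simp [hN, q, eq_comm]
  have hmoved : {h | s h ≠ h}.ncard = N.card := by
    rw [← Set.ncard_coe_finset]
    congr 1
    ext l
    simp [hN]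
  rw [hlines, hmoved, orbitRank, hinv, Nat.card_eq_fintype_card]
  omega

theorem genusDefect_pair {H : Type*} (a b : Equiv.Perm H) :
    genusDefect [a, b] =
      orbitRank {a} + orbitRank {b} + orbitRank {a * b} - 2 * orbitRank {a, b} := by
  have hset : {g | g ∈ [a, b]} = ({a, b} : Set (Equiv.Perm H)) := by
    ext g; simp
  rw [genusDefect, hset]
  simp

theorem RibbonGraph.genus_eq {H : Type*} [Finite H] (R : RibbonGraph H) :
    R.genus = (genusDefect [R.rotation, R.flip] : ℚ) / 2 := by
  have hL := (orbitRank_involution R.flip R.flip_flip).1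
  have hV := finrank_invariants_singleton R.rotation
  have hF := finrank_invariants_singleton (R.rotation * R.flip)
  have hC := finrank_invariants ({R.rotation, R.flip} : Set (Equiv.Perm H))
  change _ = (R.numLines : ℤ) at hL
  change _ = R.numVertices at hV
  change _ = R.numFaces at hF
  change _ = R.numComponents at hC
  have h : genusDefect [R.rotation, R.flip] =
      2 * (R.numComponents : ℤ) - (R.numVertices - R.numLines + R.numFaces) := by
    rw [genusDefect_pair, hL]
    unfold orbitRank
    rw [hV, hF, hC]
    ring
  rw [RibbonGraph.genus, h]
  push_cast
  ring

/-- Adding fixed points to a family of permutations does not change its orbit rank. -/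
theorem orbitRank_image_viaEmbedding {W H : Type*} [Finite H] (ι : W ↪ H)
    (S : Set (Equiv.Perm W)) :
    orbitRank (Equiv.Perm.viaEmbeddingHom ι '' S) = orbitRank S := by
  classical
  have := Fintype.ofFinite H
  have := Finite.of_injective ι ι.injective
  have := Fintype.ofFinite W
  have happ : ∀ (g : Equiv.Perm W) w, Equiv.Perm.viaEmbeddingHom ι g (ι w) = ι (g w) :=
    fun g w => Equiv.Perm.viaEmbedding_apply g ι w
  have hfix : ∀ (g : Equiv.Perm W) x, x ∉ Set.range ι → Equiv.Perm.viaEmbeddingHom ι g x = x :=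
    fun g x hx => Equiv.Perm.viaEmbedding_apply_of_notMem g ι x hx
  let E : (W → ℚ) → ({x // x ∉ Set.range ι} → ℚ) → H → ℚ := fun F k x =>
    if h : x ∈ Set.range ι then F h.choose else k ⟨x, h⟩
  have hE : ∀ F k w, E F k (ι w) = F w := fun F k w => by
    have h : ι w ∈ Set.range ι := ⟨w, rfl⟩
    simp only [E, dif_pos h]
    exact congrArg F (ι.injective h.choose_spec)
  let e : invariants (Equiv.Perm.viaEmbeddingHom ι '' S) ≃ₗ[ℚ]
      invariants S × ({x // x ∉ Set.range ι} → ℚ) :=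
    { toFun := fun f => (⟨fun w => f.1 (ι w), fun g hg w => by
        simpa only [happ] using f.2 _ ⟨g, hg, rfl⟩ (ι w)⟩, fun x => f.1 x)
      map_add' := fun _ _ => rfl
      map_smul' := fun _ _ => rfl
      invFun := fun p => ⟨E p.1.1 p.2, by
        rintro _ ⟨g, hg, rfl⟩ x
        by_cases hx : x ∈ Set.range ι
        · obtain ⟨w, rfl⟩ := hx
          rw [happ, hE, hE]
          exact p.1.2 g hg w
        · rw [hfix g x hx]⟩
      left_inv := fun f => by
        ext x
        by_cases hx : x ∈ Set.range ι
        · obtain ⟨w, rfl⟩ := hx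
          exact hE _ _ w
        · simp only [E, dif_neg hx]
      right_inv := fun p => by
        refine Prod.ext (Subtype.ext (funext fun w => hE _ _ w)) (funext fun x => ?_)
        simp only [E, dif_neg x.2] }
  have h1 := e.finrank_eq
  rw [finrank_prod, finrank_fintype_fun_eq_card] at h1
  have h2 : Fintype.card {x // x ∉ Set.range ι} = Fintype.card H - Fintype.card W := by
    rw [Fintype.card_subtype_compl]
    congr 1
    exact (Fintype.card_congr (Equiv.ofInjective ι ι.injective)).symm
  have h3 := Fintype.card_le_of_embedding ι
  unfold orbitRank
  rw [Nat.card_eq_fintype_card, Nat.card_eq_fintype_card]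
  omega

theorem genusDefect_map_viaEmbedding {W H : Type*} [Finite H] (ι : W ↪ H)
    (L : List (Equiv.Perm W)) :
    genusDefect (L.map (Equiv.Perm.viaEmbeddingHom ι)) = genusDefect L := by
  have h1 : ∀ g : Equiv.Perm W, orbitRank {Equiv.Perm.viaEmbeddingHom ι g} = orbitRank {g} :=
    fun g => by rw [← orbitRank_image_viaEmbedding ι {g}, Set.image_singleton]
  have h2 : {g | g ∈ L.map (Equiv.Perm.viaEmbeddingHom ι)} =
      Equiv.Perm.viaEmbeddingHom ι '' {g | g ∈ L} := by
    ext g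
    simp
  unfold genusDefect
  rw [h2, orbitRank_image_viaEmbedding, List.map_map, ← map_list_prod, h1]
  simp only [Function.comp_def, h1]

end Genus

/-! ### Closed graphs with three colors -/

namespace ColoredGraph

section Closed

variable {C W : Type*} (B : ColoredGraph C W) (hB : ∀ c v, B.line c v ≠ v)

include hB in
theorem white_line (c : C) (v : W) : B.white (B.line c v) = !B.white v :=
  B.line_white c v (hB c v)

/-- The permutation that leaves the white vertices of a closed colored graph along the lines of
color `a`, the black ones along those of color `c`. It turns around the faces of colors `a` and
`c`. -/
def faceStep (a c : C) : Equiv.Perm W where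
  toFun v := if B.white v then B.line a v else B.line c v
  invFun v := if B.white v then B.line c v else B.line a v
  left_inv v := by
    cases hv : B.white v <;> simp [hv, B.white_line hB, B.line_line]
  right_inv v := by
    cases hv : B.white v <;> simp [hv, B.white_line hB, B.line_line]

theorem faceStep_apply (a c : C) (v : W) :
    B.faceStep hB a c v = if B.white v then B.line a v else B.line c v := rfl

end Closed

section Rank

variable {W : Type*} (B : ColoredGraph (Fin 3) W) (hB : ∀ c v, B.line c v ≠ v)

theorem apply_eq_of_rotation_invariant {f : W × Fin 3 → ℚ}
    (hf : f ∈ invariants {(B.jacket (finRotate 3)).rotation}) (v : W) (i : Fin 3) :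
    f (v, i) = f (v, 0) := by
  have h1 : ∀ i, f (v, i + 1) = f (v, i) := by
    intro i
    cases hv : B.white v
    · have := mem_invariants_singleton.1 hf (v, i + 1)
      simpa [jacket, hv] using this.symm
    · have := mem_invariants_singleton.1 hf (v, i)
      simpa [jacket, hv] using this
  have h2 : f (v, 1) = f (v, 0) := h1 0
  have h3 : f (v, 2) = f (v, 1) := h1 1
  fin_cases i
  · rfl
  · exact h2
  · exact h3.trans h2

theorem finrank_invariants_rotation [Finite W] :
    finrank ℚ (invariants {(B.jacket (finRotate 3)).rotation}) = Nat.card W := by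
  have := Fintype.ofFinite W
  let e : invariants {(B.jacket (finRotate 3)).rotation} ≃ₗ[ℚ] (W → ℚ) :=
    { toFun := fun f v => f.1 (v, 0)
      map_add' := fun _ _ => rfl
      map_smul' := fun _ _ => rfl
      invFun := fun g => ⟨fun x => g x.1, mem_invariants_singleton.2 fun x => rfl⟩
      left_inv := fun f => by
        ext ⟨v, i⟩
        exact (B.apply_eq_of_rotation_invariant f.2 v i).symm
      right_inv := fun g => rfl }
  rw [e.finrank_eq, finrank_fintype_fun_eq_card, Nat.card_eq_fintype_card]

theorem finrank_invariants_rotation_flip (b : Fin 3) :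
    finrank ℚ (invariants {(B.jacket (finRotate 3)).rotation, (B.jacket (finRotate 3)).flip}) =
      finrank ℚ (invariants {B.line b, (B.faceStep hB (b - 1) (b + 1))⁻¹}) := by
  set ψ := B.faceStep hB (b - 1) (b + 1) with hψ
  have hrot : ∀ f ∈ invariants {(B.jacket (finRotate 3)).rotation, (B.jacket (finRotate 3)).flip},
      ∀ v i, f (v, i) = f (v, 0) := fun f hf =>
    B.apply_eq_of_rotation_invariant (mem_invariants_singleton.2 (hf _ (Set.mem_insert _ _)))
  have hcol := (by decide : ∀ b i : Fin 3, i = b ∨ i = b - 1 ∨ i = b + 1) b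
  have hinv : ∀ g : W → ℚ, g ∈ invariants {B.line b, ψ⁻¹} ↔ ∀ i v, g (B.line i v) = g v := by
    intro g
    constructor
    · intro hg
      have hb : ∀ v, g (B.line b v) = g v := hg _ (by simp)
      have hψg : ∀ v, g (ψ v) = g v := fun v => by
        simpa using (hg ψ⁻¹ (by simp) (ψ v)).symm
      have ha : ∀ v, B.white v = true → g (B.line (b - 1) v) = g v := fun v hv => by
        have := hψg v
        rwa [hψ, faceStep_apply, if_pos hv] at this
      have hc : ∀ v, B.white v = false → g (B.line (b + 1) v) = g v := fun v hv => by
        have := hψg v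
        rwa [hψ, faceStep_apply, if_neg (by simp [hv])] at this
      intro i v
      rcases hcol i with rfl | rfl | rfl
      · exact hb v
      · cases hv : B.white v
        · have := ha (B.line (b - 1) v) (by rw [B.white_line hB, hv]; rfl)
          rw [B.line_line] at this
          exact this.symm
        · exact ha v hv
      · cases hv : B.white v
        · exact hc v hv
        · have := hc (B.line (b + 1) v) (by rw [B.white_line hB, hv]; rfl)
          rw [B.line_line] at this
          exact this.symm
    · intro hg
      have hψg : ∀ v, g (ψ v) = g v := fun v => by
        rw [hψ, faceStep_apply]
        split_ifs <;> exact hg _ _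
      rintro s (rfl | rfl) v
      · exact hg b v
      · simpa using (hψg (ψ⁻¹ v)).symm
  let e : invariants {(B.jacket (finRotate 3)).rotation, (B.jacket (finRotate 3)).flip} ≃ₗ[ℚ]
      invariants {B.line b, ψ⁻¹} :=
    { toFun := fun f => ⟨fun v => f.1 (v, 0), (hinv _).2 fun i v => by
        have h1 : f.1 (B.line i v, i) = f.1 (v, i) := f.2 _ (.inr rfl) (v, i)
        rwa [hrot _ f.2, hrot _ f.2 v] at h1⟩
      map_add' := fun _ _ => rfl
      map_smul' := fun _ _ => rfl
      invFun := fun g => ⟨fun x => g.1 x.1, by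
        rintro s (rfl | rfl) x
        · rfl
        · exact (hinv _).1 g.2 x.2 x.1⟩
      left_inv := fun f => by
        ext ⟨v, i⟩
        exact (hrot f.1 f.2 v i).symm
      right_inv := fun g => rfl }
  exact e.finrank_eq

/-- The faces of the jacket of a closed graph with three colors are those of the colors `b - 1` and
`b + 1`, which are the cycles of `faceStep`, and those of the color `b` and one of the others; the
latter are the cycles of the product of `faceStep` with the lines of color `b`. -/
theorem finrank_invariants_faces [Finite W] (b : Fin 3) :
    finrank ℚ (invariants {(B.jacket (finRotate 3)).rotation * (B.jacket (finRotate 3)).flip}) =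
      finrank ℚ (invariants {B.faceStep hB (b - 1) (b + 1)}) +
        finrank ℚ (invariants {B.faceStep hB (b - 1) (b + 1) * B.line b}) := by
  set ψ := B.faceStep hB (b - 1) (b + 1) with hψ
  set Φ := (B.jacket (finRotate 3)).rotation * (B.jacket (finRotate 3)).flip with hΦ
  have hab : b - 1 ≠ b := (by decide : ∀ b : Fin 3, b - 1 ≠ b) b
  have hcb : b + 1 ≠ b := (by decide : ∀ b : Fin 3, b + 1 ≠ b) b
  have hac : b - 1 ≠ b + 1 := (by decide : ∀ b : Fin 3, b - 1 ≠ b + 1) b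
  have hab' : b - 1 - 1 = b + 1 := (by decide : ∀ b : Fin 3, b - 1 - 1 = b + 1) b
  have hcb' : b + 1 + 1 = b - 1 := (by decide : ∀ b : Fin 3, b + 1 + 1 = b - 1) b
  have hcol := (by decide : ∀ b i : Fin 3, i = b ∨ i = b - 1 ∨ i = b + 1) b
  have hΦw : ∀ v i, B.white v = true → Φ (v, i) = (B.line i v, i - 1) := by
    intro v i hv
    simp [hΦ, jacket, B.white_line hB, hv]
  have hΦb : ∀ v i, B.white v = false → Φ (v, i) = (B.line i v, i + 1) := by
    intro v i hv
    simp [hΦ, jacket, B.white_line hB, hv]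
  have hψw : ∀ v, B.white v = true → ψ v = B.line (b - 1) v := fun v hv => by
    rw [hψ, faceStep_apply, if_pos hv]
  have hψb : ∀ v, B.white v = false → ψ v = B.line (b + 1) v := fun v hv => by
    rw [hψ, faceStep_apply, if_neg (by simp [hv])]
  have hw : ∀ i v, B.white v = true → B.white (B.line i v) = false := fun i v hv => by
    rw [B.white_line hB, hv]; rfl
  have hb : ∀ i v, B.white v = false → B.white (B.line i v) = true := fun i v hv => by
    rw [B.white_line hB, hv]; rfl
  -- The faces of colors `b - 1` and `b + 1` contain the half-lines of color `b - 1` at white and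
  -- `b + 1` at black vertices, the other faces those of the opposite kind and all of color `b`.
  let e : invariants {Φ} ≃ₗ[ℚ] invariants {ψ} × invariants {ψ * B.line b} :=
    { toFun := fun f =>
        (⟨fun v => f.1 (v, if B.white v then b - 1 else b + 1), mem_invariants_singleton.2 fun v => by
          have h1 := mem_invariants_singleton.1 f.2
          cases hv : B.white v
          · have := h1 (v, b + 1)
            rw [hΦb v _ hv, hcb'] at this
            simpa [hψb v hv, hb, hv] using this
          · have := h1 (v, b - 1)
            rw [hΦw v _ hv, hab'] at this
            simpa [hψw v hv, hw, hv] using this⟩,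
        ⟨fun v => f.1 (v, if B.white v then b + 1 else b - 1), mem_invariants_singleton.2 fun v => by
          have h1 := mem_invariants_singleton.1 f.2
          cases hv : B.white v
          · have h2 := h1 (B.line (b - 1) (B.line b v), b - 1)
            have h3 := h1 (B.line b v, b)
            have h2' : B.white (B.line (b - 1) (B.line b v)) = false := hw _ _ (hb _ _ hv)
            rw [hΦb _ _ h2', B.line_line, sub_add_cancel] at h2
            rw [hΦw _ _ (hb _ _ hv), B.line_line] at h3
            simpa [hψw _ (hb _ _ hv), h2', hv] using h2.symm.trans h3.symm
          · have h2 := h1 (B.line (b + 1) (B.line b v), b + 1)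
            have h3 := h1 (B.line b v, b)
            have h2' : B.white (B.line (b + 1) (B.line b v)) = true := hb _ _ (hw _ _ hv)
            rw [hΦw _ _ h2', B.line_line, add_sub_cancel_right] at h2
            rw [hΦb _ _ (hw _ _ hv), B.line_line] at h3
            simpa [hψb _ (hw _ _ hv), h2', hv] using h2.symm.trans h3.symm⟩)
      map_add' := fun _ _ => rfl
      map_smul' := fun _ _ => rfl
      invFun := fun p => ⟨fun x => if x.2 = b then p.2.1 (B.line b x.1) else
          if x.2 = if B.white x.1 then b - 1 else b + 1 then p.1.1 x.1 else p.2.1 x.1, by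
        obtain ⟨⟨F, hF⟩, ⟨K, hK⟩⟩ := p
        rw [mem_invariants_singleton] at hF hK ⊢
        rintro ⟨v, i⟩
        cases hv : B.white v
        · rw [hΦb v i hv]
          rcases hcol i with rfl | rfl | rfl
          · simp [hcb, hac.symm, hb, hv]
          · have h1 := hK (B.line b (B.line (b - 1) v))
            rw [Equiv.Perm.mul_apply, B.line_line, hψw _ (hb _ _ hv), B.line_line] at h1
            simpa [hab, hac, hb, hv] using h1.symm
          · have h1 := hF v
            rw [hψb v hv] at h1
            simpa [hab, hcb, hcb', hb, hv] using h1
        · rw [hΦw v i hv]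
          rcases hcol i with rfl | rfl | rfl
          · simp [hab, hac, hw, hv]
          · have h1 := hF v
            rw [hψw v hv] at h1
            simpa [hab, hcb, hab', hw, hv] using h1
          · have h1 := hK (B.line b (B.line (b + 1) v))
            rw [Equiv.Perm.mul_apply, B.line_line, hψb _ (hw _ _ hv), B.line_line] at h1
            simpa [hcb, hac.symm, hw, hv] using h1.symm⟩
      left_inv := fun f => by
        have h1 := mem_invariants_singleton.1 f.2
        ext ⟨v, i⟩
        cases hv : B.white v
        · rcases hcol i with rfl | rfl | rfl
          · have h2 := h1 (v, i)
            rw [hΦb _ _ hv] at h2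
            simpa [hb, hv] using h2
          · simp [hab, hac, hv]
          · simp [hcb, hv]
        · rcases hcol i with rfl | rfl | rfl
          · have h2 := h1 (v, i)
            rw [hΦw _ _ hv] at h2
            simpa [hw, hv] using h2
          · simp [hab, hv]
          · simp [hcb, hac.symm, hv]
      right_inv := fun p => by
        refine Prod.ext (Subtype.ext (funext fun v => ?_)) (Subtype.ext (funext fun v => ?_))
        · cases hv : B.white v <;> simp [hab, hcb, hv]
        · cases hv : B.white v <;> simp [hab, hcb, hac, hac.symm, hv] }
  rw [e.finrank_eq, finrank_prod]

/-- The surface of a closed graph with three colors has a smaller model on the set of vertices of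
the graph: the faces of the colors `b - 1` and `b + 1` become its vertices, and the lines of the
color `b` its lines. -/
theorem genusDefect_jacket_three [Finite W] (b : Fin 3) :
    genusDefect [(B.jacket (finRotate 3)).rotation, (B.jacket (finRotate 3)).flip] =
      genusDefect [B.line b, (B.faceStep hB (b - 1) (b + 1))⁻¹] := by
  set ψ := B.faceStep hB (b - 1) (b + 1) with hψ
  have h1 := B.finrank_invariants_rotation
  have h2 := B.finrank_invariants_rotation_flip hB b
  have h3 := B.finrank_invariants_faces hB b
  have hline := (orbitRank_involution (B.line b) (B.line_line b)).2
  have hflip := (orbitRank_involution (B.jacket (finRotate 3)).flip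
    (B.jacket (finRotate 3)).flip_flip).2
  have hline' : {h | B.line b h ≠ h} = Set.univ := Set.eq_univ_of_forall fun v => hB b v
  have hflip' : {h | (B.jacket (finRotate 3)).flip h ≠ h} = Set.univ :=
    Set.eq_univ_of_forall fun x hx => hB x.2 x.1 (congrArg Prod.fst hx)
  rw [hline', Set.ncard_univ] at hline
  rw [hflip', Set.ncard_univ, Nat.card_prod, Nat.card_fin] at hflip
  have hinv : orbitRank {B.line b * ψ⁻¹} = orbitRank {ψ * B.line b} := by
    have : (B.line b)⁻¹ = B.line b := Equiv.ext fun v => by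
      rw [Equiv.Perm.inv_eq_iff_eq, B.line_line]
    rw [← orbitRank_inv, mul_inv_rev, inv_inv, this]
  have hcard : Nat.card (W × Fin 3) = Nat.card W * 3 := by rw [Nat.card_prod, Nat.card_fin]
  rw [genusDefect_pair, genusDefect_pair, hinv, orbitRank_inv]
  unfold orbitRank at hline hflip ⊢
  rw [← hψ] at h2 h3
  rw [h1, h2, h3]
  push_cast [hcard] at hflip hline ⊢
  linarith

end Rank

end ColoredGraph

/-! ### The boundary graph inside a jacket -/

section Refinement

variable {H : Type*} [Finite H]

/-- Replacing a permutation by the left one of two factors with additive lengths does not increase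
the genus. -/
theorem genusDefect_left_factor_le (L₁ L₂ : List (Equiv.Perm H)) {a p : Equiv.Perm H}
    (h : orbitRank {a} + orbitRank {a⁻¹ * p} = orbitRank {p}) :
    genusDefect (L₁ ++ a :: L₂) ≤ genusDefect (L₁ ++ p :: L₂) := by
  have hp : a * (a⁻¹ * p) = p := by group
  have h1 := genusDefect_split L₁ L₂ (a := a) (b := a⁻¹ * p) (by rw [hp, h])
  have h2 := genusDefect_drop_le (L₁ ++ [a]) L₂ (a⁻¹ * p)
  rw [hp] at h1
  rw [List.append_assoc, List.append_assoc, List.singleton_append, List.singleton_append, h1] at h2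
  exact h2

/-- The same for the inverses of the permutations. -/
theorem genusDefect_inv_left_factor_le (L₁ L₂ : List (Equiv.Perm H)) {a p : Equiv.Perm H}
    (h : orbitRank {a} + orbitRank {a⁻¹ * p} = orbitRank {p}) :
    genusDefect (L₁ ++ a⁻¹ :: L₂) ≤ genusDefect (L₁ ++ p⁻¹ :: L₂) := by
  have hp : (a⁻¹ * p)⁻¹ * a⁻¹ = p⁻¹ := by group
  have h1 := genusDefect_split L₁ L₂ (a := (a⁻¹ * p)⁻¹) (b := a⁻¹) (by
    rw [hp, orbitRank_inv, orbitRank_inv, orbitRank_inv, add_comm, h])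
  have h2 := genusDefect_drop_le L₁ (a⁻¹ :: L₂) (a⁻¹ * p)⁻¹
  rwa [h1, hp] at h2

theorem genusDefect_append_prod_inv (L : List (Equiv.Perm H)) :
    genusDefect (L ++ [L.prod⁻¹]) = genusDefect L := by
  have h1 : orbitRank {g | g ∈ L ++ [L.prod⁻¹]} = orbitRank {g | g ∈ L} := by
    refine orbitRank_congr (fun g hg => ?_) fun g hg => Subgroup.subset_closure ?_
    · rcases List.mem_append.1 hg with hg | hg
      · exact Subgroup.subset_closure hg
      · rw [List.mem_singleton.1 hg]
        exact inv_mem (list_prod_mem_closure fun g hg => hg)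
    · exact List.mem_append_left _ hg
  unfold genusDefect
  rw [h1]
  simp [orbitRank_inv, orbitRank_one]

end Refinement

namespace ColoredGraph

variable {V : Type*} (Γ : ColoredGraph (Fin 4) V)

/-- An external vertex, regarded as the half-line of color `0` at it, which is its external leg. -/
def externalLeg : {v : V // Γ.IsExternal v} ↪ V × Fin 4 where
  toFun v := (v.1, 0)
  inj' _ _ h := Subtype.ext (congrArg Prod.fst h)

theorem mem_range_externalLeg {x : V × Fin 4} :
    x ∈ Set.range Γ.externalLeg ↔ x.2 = 0 ∧ Γ.IsExternal x.1 := by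
  constructor
  · rintro ⟨v, rfl⟩
    exact ⟨rfl, v.2⟩
  · obtain ⟨v, c⟩ := x
    rintro ⟨rfl, hv⟩
    exact ⟨⟨v, hv⟩, rfl⟩

/-- A permutation of the half-lines that follows the strand of the colors `0` and `x` from an
external leg returns to the external legs at the other end of the strand. -/
theorem firstReturn_of_follows_strand [Finite V] (Φ : Equiv.Perm (V × Fin 4)) (x : Fin 3)
    (v : {v : V // Γ.IsExternal v}) (h : ∀ (c : Fin 3) v, Γ.line c.succ v ≠ v)
    (h0 : Φ (v.1, 0) = (v.1, x.succ))
    (h1 : ∀ u, Γ.white u = Γ.white v.1 → Φ (u, x.succ) = (Γ.line x.succ u, 0))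
    (h2 : ∀ u, Γ.white u = !Γ.white v.1 → ¬ Γ.IsExternal u → Φ (u, 0) = (Γ.line 0 u, x.succ)) :
    ∃ k : ℕ, 0 < k ∧ (Φ ^ k) (Γ.externalLeg v) = Γ.externalLeg (Γ.strandEnd x v) ∧
      ∀ j, 0 < j → j < k → (Φ ^ j) (Γ.externalLeg v) ∉ Set.range Γ.externalLeg := by
  set N := Γ.strandLength x v with hN
  have hNpos : 0 < N := Γ.strandLength_pos x v
  have hstep : ∀ u, Γ.strandStep x u = Γ.line 0 (Γ.line x.succ u) := fun u => rfl
  have hext : ∀ u, Γ.IsExternal u → Γ.IsExternal (Γ.line 0 u) := fun u hu => by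
    rw [show Γ.line 0 u = u from hu]; exact hu
  have hpow : ∀ n y, (Φ ^ (n + 1)) y = Φ ((Φ ^ n) y) := fun n y => by
    rw [pow_succ', Equiv.Perm.mul_apply]
  have hspow : ∀ n u, (Γ.strandStep x ^ (n + 1)) u
      = Γ.line 0 (Γ.line x.succ ((Γ.strandStep x ^ n) u)) := fun n u => by
    rw [pow_succ', Equiv.Perm.mul_apply, hstep]
  -- The line of color `x` ends outside the external vertices until the strand does.
  have hmid : ∀ n, n + 1 < N →
      ¬ Γ.IsExternal (Γ.line x.succ ((Γ.strandStep x ^ n) v.1)) := by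
    intro n hn hu
    refine Γ.strandLength_min x v n.succ_pos hn ?_
    rw [hspow]
    exact hext _ hu
  have hodd : ∀ n, n < N → Γ.white ((Γ.strandStep x ^ n) v.1) = Γ.white v.1 ∧
      (Φ ^ (2 * n + 1)) (Γ.externalLeg v) = ((Γ.strandStep x ^ n) v.1, x.succ) := by
    intro n
    induction n with
    | zero => exact fun _ => ⟨rfl, h0⟩
    | succ n ih =>
      intro hn
      obtain ⟨ihw, ihΦ⟩ := ih (by omega)
      have hu := hmid n hn
      have huw : Γ.white (Γ.line x.succ ((Γ.strandStep x ^ n) v.1)) = !Γ.white v.1 := by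
        rw [Γ.line_white _ _ (h x _), ihw]
      refine ⟨?_, ?_⟩
      · rw [hspow, Γ.line_white _ _ hu, huw, Bool.not_not]
      · rw [show 2 * (n + 1) + 1 = 2 * n + 1 + 1 + 1 by ring, hpow, hpow, ihΦ, h1 _ ihw,
          h2 _ huw hu, hspow]
  have heven : ∀ n, n < N → (Φ ^ (2 * n + 2)) (Γ.externalLeg v) =
      (Γ.line x.succ ((Γ.strandStep x ^ n) v.1), 0) := by
    intro n hn
    obtain ⟨hw, hΦ⟩ := hodd n hn
    rw [show 2 * n + 2 = 2 * n + 1 + 1 by ring, hpow, hΦ, h1 _ hw]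
  refine ⟨2 * N, by omega, ?_, fun j hj0 hj hmem => ?_⟩
  · have h3 := heven (N - 1) (by omega)
    rw [show 2 * (N - 1) + 2 = 2 * N by omega] at h3
    rw [h3]
    refine Prod.ext ?_ rfl
    have h4 : (Γ.strandEnd x v).1 = Γ.line 0 (Γ.line x.succ ((Γ.strandStep x ^ (N - 1)) v.1)) := by
      rw [← hspow, show N - 1 + 1 = N by omega]; rfl
    have h5 : Γ.line 0 (Γ.strandEnd x v).1 = (Γ.strandEnd x v).1 := (Γ.strandEnd x v).2
    change _ = (Γ.strandEnd x v).1
    rw [← h5, h4, Γ.line_line]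
  · rw [mem_range_externalLeg] at hmem
    rcases Nat.even_or_odd' j with ⟨m, rfl | rfl⟩
    · obtain ⟨n, rfl⟩ : ∃ n, m = n + 1 := ⟨m - 1, by omega⟩
      rw [mul_add, mul_one, heven n (by omega)] at hmem
      exact hmid n (by omega) hmem.2
    · rw [(hodd m (by omega)).2] at hmem
      exact Fin.succ_ne_zero x hmem.1

/-- The exchange of the half-lines of colors `0` and `b` at each vertex. -/
def exchange (V : Type*) (b : Fin 3) : Equiv.Perm (V × Fin 4) :=
  Equiv.prodCongr (Equiv.refl V) (Equiv.swap 0 b.succ)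

/-- The flip of the lines of colors `0` and `b`; the half-lines of other colors stay fixed. -/
def bicolorFlip (b : Fin 3) : Equiv.Perm (V × Fin 4) :=
  Function.Involutive.toPerm
    (fun x => if x.2 = 0 ∨ x.2 = b.succ then (Γ.line x.2 x.1, x.2) else x) fun x => by
      by_cases hx : x.2 = 0 ∨ x.2 = b.succ <;> simp [hx, Γ.line_line]

theorem bicolorFlip_apply (b : Fin 3) (x : V × Fin 4) :
    Γ.bicolorFlip b x = if x.2 = 0 ∨ x.2 = b.succ then (Γ.line x.2 x.1, x.2) else x := rfl

/-- The cyclic order of the colors in a jacket is `0, b - 1, b, b + 1`, where `b` is the color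
opposite to `0`. -/
theorem jacketCycle_apply : ∀ b : Fin 3,
    (jacketCycle (b - 1) 0 = (b - 1).succ ∧ jacketCycle (b - 1) (b - 1).succ = b.succ ∧
      jacketCycle (b - 1) b.succ = (b + 1).succ ∧ jacketCycle (b - 1) (b + 1).succ = 0) ∧
    ((jacketCycle (b - 1)).symm 0 = (b + 1).succ ∧
      (jacketCycle (b - 1)).symm (b + 1).succ = b.succ ∧
      (jacketCycle (b - 1)).symm b.succ = (b - 1).succ ∧
      (jacketCycle (b - 1)).symm (b - 1).succ = 0) := by
  decide

variable (h : ∀ (c : Fin 3) v, Γ.line c.succ v ≠ v)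

include h in
theorem boundary_line_ne [Finite V] (c : Fin 3) (v : {v : V // Γ.IsExternal v}) :
    (Γ.boundary h).line c v ≠ v := by
  intro hv
  have h1 := Γ.strandEnd_white h c v
  rw [show Γ.strandEnd c v = v from hv] at h1
  simp at h1

/-- In each cycle of the rotation, the first return to the colors `0` and `b` exchanges them. -/
theorem orbitRank_exchange_add [Finite V] (b : Fin 3) :
    orbitRank {exchange V b} +
        orbitRank {(exchange V b)⁻¹ * (Γ.jacket (jacketCycle (b - 1))).rotation} =
      orbitRank {(Γ.jacket (jacketCycle (b - 1))).rotation} := by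
  obtain ⟨⟨t0, ta, tb, tc⟩, s0, sc, sb, sa⟩ := jacketCycle_apply b
  have hac : b - 1 ≠ b ∧ b + 1 ≠ b := (by decide : ∀ b : Fin 3, b - 1 ≠ b ∧ b + 1 ≠ b) b
  refine orbitRank_add_of_firstReturn {x | x.2 = 0 ∨ x.2 = b.succ} ?_ ?_
  · rintro ⟨v, c⟩ hx
    simp only [Set.mem_ofPred_eq, not_or] at hx
    exact Prod.ext rfl (Equiv.swap_apply_of_ne_of_ne hx.1 hx.2)
  · rintro ⟨v, c⟩ hx
    refine ⟨2, two_pos, ?_, fun j hj0 hj => ?_⟩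
    · rw [pow_two, Equiv.Perm.mul_apply]
      rcases hx with hx | hx <;> obtain rfl : c = _ := hx <;> cases hv : Γ.white v <;>
        simp [jacket, exchange, *]
    · obtain rfl : j = 1 := by omega
      rw [pow_one]
      rcases hx with hx | hx <;> obtain rfl : c = _ := hx <;> cases hv : Γ.white v <;>
        simp [jacket, *]

theorem orbitRank_bicolorFlip_add [Finite V] (τ : Equiv.Perm (Fin 4)) (b : Fin 3) :
    orbitRank {Γ.bicolorFlip b} + orbitRank {(Γ.bicolorFlip b)⁻¹ * (Γ.jacket τ).flip} =
      orbitRank {(Γ.jacket τ).flip} := by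
  refine orbitRank_add_of_firstReturn {x | x.2 = 0 ∨ x.2 = b.succ} (fun x hx => ?_)
    fun x hx => ⟨1, one_pos, ?_, fun j _ _ => by omega⟩
  · exact if_neg hx
  · exact (if_pos hx).symm

/-- The external faces of the pinched jacket run alternately along the external strands of colors
`b - 1` and `b + 1`. -/
theorem orbitRank_faceStep_add [Finite V] (b : Fin 3) :
    orbitRank {Equiv.Perm.viaEmbeddingHom Γ.externalLeg
        ((Γ.boundary h).faceStep (Γ.boundary_line_ne h) (b - 1) (b + 1))} +
      orbitRank {(Equiv.Perm.viaEmbeddingHom Γ.externalLeg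
        ((Γ.boundary h).faceStep (Γ.boundary_line_ne h) (b - 1) (b + 1)))⁻¹ *
          ((Γ.jacket (jacketCycle (b - 1))).rotation * (Γ.jacket (jacketCycle (b - 1))).flip)} =
      orbitRank {(Γ.jacket (jacketCycle (b - 1))).rotation *
        (Γ.jacket (jacketCycle (b - 1))).flip} := by
  obtain ⟨⟨t0, -, -, tc⟩, s0, -, -, sa⟩ := jacketCycle_apply b
  refine orbitRank_add_of_firstReturn (Set.range Γ.externalLeg)
    (fun x hx => Equiv.Perm.viaEmbedding_apply_of_notMem _ _ x hx) ?_
  rintro _ ⟨v, rfl⟩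
  have hv0 : Γ.line 0 v.1 = v.1 := v.2
  have hB : (Γ.boundary h).white v = Γ.white v.1 := rfl
  rw [Equiv.Perm.viaEmbeddingHom_apply, Equiv.Perm.viaEmbedding_apply, faceStep_apply, hB]
  cases hv : Γ.white v.1
  · refine Γ.firstReturn_of_follows_strand _ (b + 1) v h ?_ (fun u hu => ?_) fun u hu hu' => ?_
    · simp [jacket, hv0, hv, s0]
    · rw [hv] at hu
      simp [jacket, Γ.line_white _ _ (h _ _), hu, tc]
    · rw [hv] at hu
      simp [jacket, Γ.line_white _ _ hu', hu, s0]
  · refine Γ.firstReturn_of_follows_strand _ (b - 1) v h ?_ (fun u hu => ?_) fun u hu hu' => ?_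
    · simp [jacket, hv0, hv, t0]
    · rw [hv] at hu
      simp [jacket, Γ.line_white _ _ (h _ _), hu, sa]
    · rw [hv] at hu
      simp [jacket, Γ.line_white _ _ hu', hu, t0]

/-- The external strands of color `b` are paths of lines of the colors `0` and `b`, joined to each
other at the vertices. -/
theorem orbitRank_boundary_line_add [Finite V] (b : Fin 3) :
    orbitRank {Equiv.Perm.viaEmbeddingHom Γ.externalLeg ((Γ.boundary h).line b)} +
      orbitRank {(Equiv.Perm.viaEmbeddingHom Γ.externalLeg ((Γ.boundary h).line b))⁻¹ *
        (exchange V b * Γ.bicolorFlip b)} =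
      orbitRank {exchange V b * Γ.bicolorFlip b} := by
  refine orbitRank_add_of_firstReturn (Set.range Γ.externalLeg)
    (fun x hx => Equiv.Perm.viaEmbedding_apply_of_notMem _ _ x hx) ?_
  rintro _ ⟨v, rfl⟩
  have hv0 : Γ.line 0 v.1 = v.1 := v.2
  rw [Equiv.Perm.viaEmbeddingHom_apply, Equiv.Perm.viaEmbedding_apply]
  refine Γ.firstReturn_of_follows_strand _ b v h ?_ (fun u _ => ?_) fun u _ _ => ?_
  · simp [bicolorFlip_apply, exchange, hv0]
  · simp [bicolorFlip_apply, exchange]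
  · simp [bicolorFlip_apply, exchange]

/-- The surface of the boundary graph, without some discs, is a part of the surface of each pinched
jacket: it consists of the external faces and the ribbons of the strands of color `b`, the color
opposite to `0` in the jacket. -/
theorem genusDefect_boundary_le [Finite V] (b : Fin 3) :
    genusDefect [((Γ.boundary h).jacket (finRotate 3)).rotation,
        ((Γ.boundary h).jacket (finRotate 3)).flip] ≤
      genusDefect [(Γ.jacket (jacketCycle (b - 1))).rotation,
        (Γ.jacket (jacketCycle (b - 1))).flip] := by
  rw [genusDefect_jacket_three _ (Γ.boundary_line_ne h) b]
  set σ := (Γ.jacket (jacketCycle (b - 1))).rotation with hσ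
  set α := (Γ.jacket (jacketCycle (b - 1))).flip with hα
  set ψ := (Γ.boundary h).faceStep (Γ.boundary_line_ne h) (b - 1) (b + 1) with hψ
  set ι := Equiv.Perm.viaEmbeddingHom Γ.externalLeg with hι
  calc genusDefect [(Γ.boundary h).line b, ψ⁻¹]
      = genusDefect [ι ((Γ.boundary h).line b), (ι ψ)⁻¹] := by
        rw [← genusDefect_map_viaEmbedding Γ.externalLeg]
        simp [hι]
    _ ≤ genusDefect [exchange V b * Γ.bicolorFlip b, (ι ψ)⁻¹] :=
        genusDefect_left_factor_le [] [(ι ψ)⁻¹] (Γ.orbitRank_boundary_line_add h b)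
    _ ≤ genusDefect [exchange V b, Γ.bicolorFlip b, (ι ψ)⁻¹] :=
        genusDefect_fuse_le [] [(ι ψ)⁻¹] _ _
    _ ≤ genusDefect [σ, Γ.bicolorFlip b, (ι ψ)⁻¹] :=
        genusDefect_left_factor_le [] [Γ.bicolorFlip b, (ι ψ)⁻¹] (Γ.orbitRank_exchange_add b)
    _ ≤ genusDefect [σ, α, (ι ψ)⁻¹] :=
        genusDefect_left_factor_le [σ] [(ι ψ)⁻¹] (Γ.orbitRank_bicolorFlip_add _ b)
    _ ≤ genusDefect [σ, α, (σ * α)⁻¹] :=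
        genusDefect_inv_left_factor_le [σ, α] [] (Γ.orbitRank_faceStep_add h b)
    _ = genusDefect [σ, α] := by
        have := genusDefect_append_prod_inv [σ, α]
        simpa using this

end ColoredGraph

theorem mainTheorem5 {I : Type*} [Finite I] (G : TensorGraph I) :
    (∀ J : Fin 3, G.boundaryGenus ≤ G.pinchedJacketGenus J) ∧
      ∃ n : ℕ, (∑ J : Fin 3, G.pinchedJacketGenus J) - 3 * G.boundaryGenus = n := by
  -- The defects are even, so that each jacket exceeds the boundary by a natural number.
  have key : ∀ J : Fin 3, ∃ n : ℕ, G.pinchedJacketGenus J = G.boundaryGenus + n := by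
    intro J
    have hle := G.colorExtension.genusDefect_boundary_le G.colorExtension_line_succ_ne (J + 1)
    rw [add_sub_cancel_right] at hle
    obtain ⟨p, hp⟩ := even_genusDefect
      [(G.colorExtension.jacket (ColoredGraph.jacketCycle J)).rotation,
        (G.colorExtension.jacket (ColoredGraph.jacketCycle J)).flip]
    obtain ⟨q, hq⟩ := even_genusDefect
      [(G.boundaryGraph.jacket (finRotate 3)).rotation,
        (G.boundaryGraph.jacket (finRotate 3)).flip]
    have hle' : q ≤ p := by
      change genusDefect [(G.boundaryGraph.jacket (finRotate 3)).rotation,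
        (G.boundaryGraph.jacket (finRotate 3)).flip] ≤ _ at hle
      omega
    obtain ⟨n, hn⟩ := Int.eq_ofNat_of_zero_le (sub_nonneg.2 hle')
    refine ⟨n, ?_⟩
    rw [TensorGraph.pinchedJacketGenus, TensorGraph.boundaryGenus, RibbonGraph.genus_eq,
      RibbonGraph.genus_eq, hp, hq, show p = q + n by omega]
    push_cast
    ring
  refine ⟨fun J => ?_, ?_⟩
  · obtain ⟨n, hn⟩ := key J
    rw [hn]
    exact le_add_of_nonneg_right n.cast_nonneg
  · choose n hn using key
    refine ⟨n 0 + n 1 + n 2, ?_⟩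
    rw [Fin.sum_univ_three, hn, hn, hn]
    push_cast
    ring
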